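/- Let $P:\mathbb Z^2\to\mathbb R^2$ be a circular net, i.e. for all $(i,j)\in\mathbb Z^2$ the four points $P_{i,j},P_{i+1,j},P_{i+1,j+1},P_{i,j+1}$ lie on a circle. Suppose that for every $i\in\mathbb Z$ the points $\{P_{i,j}\}_{j\in\mathbb Z}$ lie on a circle $\mathcal V_i$ (of positive radius), and that for every $j\in\mathbb Z$ the points $\{P_{i,j}\}_{i\in\mathbb Z}$ lie on a circle $\mathcal H_j$ (of positive radius). Suppose further that the net is generic in the following sense: - for all $(i,j)$, the four points $P_{i,j},P_{i+1,j},P_{i+1,j+1},P_{i,j+1}$ are pairwise distinct, and any three consecutive vertices of a parameter line are pairwise distinct, i.e. also $P_{i,j}\ne P_{i+2,j}$ and $P_{i,j}\neq P_{i,j+2}$; - in each of the families $(\mathcal V_i)_{i\in\mathbb Z}$ and $(\mathcal H_j)_{j\in\mathbb Z}$, no three of any five consecutive circles have collinear centres, and no three consecutive circles pass through a common point. Then the following hold. 1. The centres of the circles $\{\mathcal H_j\}_{j\in\mathbb Z}$ are contained in a (non-degenerate, real) conic $\mathcal Q_{\mathcal H}$. 2. The centres of the circles $\{\mathcal V_i\}_{i\in\mathbb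 Z}$ are contained in a (non-degenerate, real) conic $\mathcal Q_{\mathcal V}$. 3. These conics can be chosen such that $\mathcal Q_{\mathcal H}$ and $\mathcal Q_{\mathcal V}$ are confocal. 4. The circles $\{\mathcal H_j\}_{j\in\mathbb Z}$ have a common orthogonal circle $\mathcal K_{\mathcal H}$. 5. The circles $\{\mathcal V_i\}_{i\in\mathbb Z}$ have a common orthogonal circle $\mathcal K_{\mathcal V}$. 6. These circles can be chosen such that $\mathcal K_{\mathcal H}$ and $\mathcal K_{\mathcal V}$ are orthogonal. Here $\mathcal K_{\mathcal H}$ and $\mathcal K_{\mathcal V}$ are circles with real centre and nonzero real squared radius, which may be negative (an imaginary circle); two such circles with centres $c,c'$ and squared radii $\rho,\rho'$ are orthogonal if $|c-c'|^2=\rho+\rho'$. Two non-degenerate conics are confocal (in the sense of Darboux) if their dual conics belong to a common pencil that also contains the degenerate dual conic $u_1^2+u_2^2=0$, whose dual is the pair of circular points at infinity; here $(u_1,u_2,u_3)$ are the coordinates of the line $u_1x+u_2y+u_3=0$. -/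

import Mathlib

open EuclideanGeometry Matrix

noncomputable section

namespace CircularNet

/-- The Euclidean plane. -/
abbrev Plane : Type := EuclideanSpace ℝ (Fin 2)

/-- A map from the square lattice to the plane is a circular net if the four vertices of every
elementary quad lie on a circle. -/
def IsCircularNet (P : ℤ → ℤ → Plane) : Prop :=
  ∀ i j : ℤ, Cospherical ({P i j, P (i + 1) j, P (i + 1) (j + 1), P i (j + 1)} : Set Plane)

/-- A circle of the plane with real centre, possibly imaginary: it is given by its centre and its
nonzero squared radius. It is real when the squared radius is positive and imaginary (purely
imaginary radius) when the squared radius is negative. -/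
structure GenCircle where
  center : Plane
  sqRadius : ℝ
  sqRadius_ne_zero : sqRadius ≠ 0

/-- An ordinary circle of positive radius. -/
def GenCircle.ofSphere (S : Sphere Plane) (hS : 0 < S.radius) : GenCircle where
  center := S.center
  sqRadius := S.radius ^ 2
  sqRadius_ne_zero := (pow_pos hS 2).ne'

/-- Orthogonality of two (possibly imaginary) circles: the squared distance of the centres is the
sum of the squared radii (that is, the Lorentz product of the Moebius representatives is zero). -/
def GenCircle.Orthogonal (K₁ K₂ : GenCircle) : Prop :=
  dist K₁.center K₂.center ^ 2 = K₁.sqRadius + K₂.sqRadius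

/-- Homogeneous coordinates `(x, y, 1)` of a point of the plane. -/
def homog (p : Plane) : Fin 3 → ℝ := ![p 0, p 1, 1]

/-- A real non-degenerate conic, given by an invertible symmetric matrix
with respect to homogeneous coordinates. -/
structure Conic where
  mat : Matrix (Fin 3) (Fin 3) ℝ
  isSymm : mat.IsSymm
  det_ne_zero : mat.det ≠ 0

/-- The point `p` lies on the conic. -/
def Conic.Contains (Q : Conic) (p : Plane) : Prop :=
  homog p ⬝ᵥ (Q.mat *ᵥ homog p) = 0

/-- The matrix of the dual conic, with respect to homogeneous line coordinates. -/
def Conic.dualMat (Q : Conic) : Matrix (Fin 3) (Fin 3) ℝ := Q.mat⁻¹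

/-- The degenerate conic `u₁² + u₂² = 0` in line coordinates,
whose dual is the pair of circular points at infinity. -/
def absoluteDual : Matrix (Fin 3) (Fin 3) ℝ := !![1, 0, 0; 0, 1, 0; 0, 0, 0]

/-- Darboux's definition of confocality: the dual conics lie in a common pencil which also contains
the degenerate dual conic of the circular points at infinity. -/
def Conic.Confocal (Q₁ Q₂ : Conic) : Prop :=
  ∃ L : Submodule ℝ (Matrix (Fin 3) (Fin 3) ℝ),
    Module.finrank ℝ L = 2 ∧ absoluteDual ∈ L ∧ Q₁.dualMat ∈ L ∧ Q₂.dualMat ∈ L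

/-- General position of the vertices: the four vertices of every elementary quad are pairwise
distinct, and any three consecutive vertices of a parameter line are pairwise distinct. -/
structure GenericVertices (P : ℤ → ℤ → Plane) : Prop where
  edge_fst : ∀ i j, P i j ≠ P (i + 1) j
  edge_snd : ∀ i j, P i j ≠ P i (j + 1)
  diagonal : ∀ i j, P i j ≠ P (i + 1) (j + 1)
  antidiagonal : ∀ i j, P (i + 1) j ≠ P i (j + 1)
  consecutive_fst : ∀ i j, P i j ≠ P (i + 2) j
  consecutive_snd : ∀ i j, P i j ≠ P i (j + 2)

/-- General position of a family of circles: no three of any five consecutive circles have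
collinear centres, and no three consecutive circles pass through a common point. -/
structure GenericCircles (S : ℤ → Sphere Plane) : Prop where
  centers : ∀ i j k : ℤ, i < j → j < k → k ≤ i + 4 →
    ¬ Collinear ℝ ({(S i).center, (S j).center, (S k).center} : Set Plane)
  no_common_point : ∀ (i : ℤ) (p : Plane), ¬ (p ∈ S i ∧ p ∈ S (i + 1) ∧ p ∈ S (i + 2))

end CircularNet

end

open CircularNet

/-! Each circle becomes a unit vector of a Lorentz space of dimension four; for intersecting circles
`lor` is the cosine of their angle. Write `v i`, `h j` for the vectors of the two families.

Opposite angles in a circular quad make the product of the four crossings equal to `1`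
(`crossing_quad`). Conjugating on one colour of the checkerboard turns this into a multiplicative
splitting, and taking real parts gives `lor (v i) (h j) = a i · b j` with unit vectors `a i`, `b j`
of the Euclidean plane (`exists_re_eq_of_quad`).

The rank being two, some `k` in the span of the `v i` is orthogonal to every `h j`, and some `l` in
the span of the `h j` to every `v i`; hence `k ⊥ l`. These are the two orthogonal circles. On the
complement of `k, l` a rotation yields an orthogonal basis `g₁, g₂` in which the families have dual
coordinates (`exists_isAdaptedFrame`).

Subtracting `lor (h j) (h j) = 1` from `b₁² + b₂² = 1` gives a diagonal quadratic equation, likewise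
for `v i`. The first three coordinates of a circle are homogeneous coordinates of its centre, so
these equations are conics through the centres. Their dual matrices add up to minus the inverse
Lorentz form restricted to three coordinates, which is `-absoluteDual`. -/

namespace CircularNet

open ComplexConjugate

/-! ### The angles between the two families of circles -/

/-- The complex number representing a point of the plane. -/
def toC (p : Plane) : ℂ := ⟨p 0, p 1⟩

lemma toC_injective : Function.Injective toC := by
  intro p q h
  have h0 := congrArg Complex.re h
  have h1 := congrArg Complex.im h
  ext i
  fin_cases i
  · exact h0
  · exact h1

lemma dist_sq (p q : Plane) : dist p q ^ 2 = (p 0 - q 0) ^ 2 + (p 1 - q 1) ^ 2 := by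
  rw [EuclideanSpace.dist_sq_eq, Fin.sum_univ_two, Real.dist_eq, Real.dist_eq, sq_abs, sq_abs]

lemma sq_add_sq_of_mem {S : Sphere Plane} {p : Plane} (h : p ∈ S) :
    (p 0 - S.center 0) ^ 2 + (p 1 - S.center 1) ^ 2 = S.radius ^ 2 := by
  rw [← dist_sq, EuclideanGeometry.mem_sphere.mp h]

/-- The unit normal of the circle `S` at its point `p`. -/
noncomputable def unitNormal (S : Sphere Plane) (p : Plane) : ℂ := (toC p - toC S.center) / S.radius

lemma unitNormal_mul_conj {S : Sphere Plane} (hS : S.radius ≠ 0) {p : Plane} (h : p ∈ S) :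
    unitNormal S p * conj (unitNormal S p) = 1 := by
  have hp := sq_add_sq_of_mem h
  rw [Complex.mul_conj, unitNormal, Complex.normSq_div, Complex.normSq_ofReal]
  norm_cast
  rw [div_eq_one_iff_eq (by simpa using hS)]
  simp only [Complex.normSq_apply, toC, Complex.sub_re, Complex.sub_im]
  linarith

/-- The product of the unit normals of a circle at the ends of a chord depends only on the
chord. -/
lemma unitNormal_mul_unitNormal {S : Sphere Plane} (hS : S.radius ≠ 0) {p q : Plane}
    (hp : p ∈ S) (hq : q ∈ S) (hpq : p ≠ q) :
    unitNormal S p * unitNormal S q = -(toC p - toC q) / conj (toC p - toC q) := by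
  have h1 := unitNormal_mul_conj hS hp
  have h2 := unitNormal_mul_conj hS hq
  have hE : toC p - toC q = S.radius * (unitNormal S p - unitNormal S q) := by
    have : (S.radius : ℂ) ≠ 0 := by exact_mod_cast hS
    rw [unitNormal, unitNormal]; field_simp; ring
  have h0 : conj (toC p - toC q) ≠ 0 := by
    rw [Ne, map_eq_zero, sub_eq_zero]
    exact fun h => hpq (toC_injective h)
  rw [eq_div_iff h0, hE]
  simp only [map_mul, map_sub, Complex.conj_ofReal]
  linear_combination (S.radius : ℂ) * (unitNormal S q * h1 - unitNormal S p * h2)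

/-- The unit complex number whose argument is the angle at `p` between two circles. -/
noncomputable def crossing (S T : Sphere Plane) (p : Plane) : ℂ := unitNormal T p * conj (unitNormal S p)

lemma crossing_mul_conj {S T : Sphere Plane} (hS : S.radius ≠ 0) (hT : T.radius ≠ 0) {p : Plane}
    (h : p ∈ S) (h' : p ∈ T) : crossing S T p * conj (crossing S T p) = 1 := by
  have h1 := unitNormal_mul_conj hS h
  have h2 := unitNormal_mul_conj hT h'
  simp only [crossing, map_mul, Complex.conj_conj]
  linear_combination unitNormal T p * conj (unitNormal T p) * h1 + h2

/-- Law of cosines in the triangle formed by `p` and the two centres. -/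
lemma crossing_re {S T : Sphere Plane} (hS : S.radius ≠ 0) (hT : T.radius ≠ 0) {p : Plane}
    (h : p ∈ S) (h' : p ∈ T) :
    2 * S.radius * T.radius * (crossing S T p).re =
      S.radius ^ 2 + T.radius ^ 2 - dist S.center T.center ^ 2 := by
  have h1 := sq_add_sq_of_mem h
  have h2 := sq_add_sq_of_mem h'
  rw [dist_sq]
  have : (crossing S T p).re = ((p 0 - S.center 0) * (p 0 - T.center 0) +
      (p 1 - S.center 1) * (p 1 - T.center 1)) / (S.radius * T.radius) := by
    simp only [crossing, unitNormal, toC, Complex.mul_re, Complex.conj_re, Complex.conj_im,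
      Complex.div_ofReal_re, Complex.div_ofReal_im, Complex.sub_re, Complex.sub_im]
    field_simp
    ring
  rw [this]
  field_simp
  linarith

/-- For four circles through the consecutive vertices of a circular quadrilateral, the product of
the four crossings at the vertices is `1`. -/
lemma crossing_quad {V V' H H' : Sphere Plane} {p q s t : Plane}
    (hV : V.radius ≠ 0) (hV' : V'.radius ≠ 0) (hH : H.radius ≠ 0) (hH' : H'.radius ≠ 0)
    (hc : Cospherical ({p, q, s, t} : Set Plane))
    (pV : p ∈ V) (tV : t ∈ V) (qV : q ∈ V') (sV : s ∈ V')
    (pH : p ∈ H) (qH : q ∈ H) (sH : s ∈ H') (tH : t ∈ H')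
    (hpq : p ≠ q) (hqs : q ≠ s) (hst : s ≠ t) (htp : t ≠ p) :
    crossing V H p * crossing V' H q * crossing V' H' s * crossing V H' t = 1 := by
  obtain ⟨o, ρ, hρ⟩ := hc
  have hmem : ∀ x ∈ ({p, q, s, t} : Set Plane), x ∈ (⟨o, ρ⟩ : Sphere Plane) := fun x hx =>
    EuclideanGeometry.mem_sphere.mpr (hρ x hx)
  set C : Sphere Plane := ⟨o, ρ⟩
  have hp := hmem p (by simp)
  have hq := hmem q (by simp)
  have hs := hmem s (by simp)
  have ht := hmem t (by simp)
  -- `Cospherical` allows radius `0`, which would force `p = q`.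
  have hC : C.radius ≠ 0 := by
    intro h0
    apply hpq
    have h1 := hρ p (by simp)
    have h2 := hρ q (by simp)
    rw [show ρ = 0 from h0, dist_eq_zero] at h1 h2
    rw [h1, h2]
  -- Each side of the quad is a chord of `C` and of a parameter circle, so both give the same
  -- product of normals.
  have e1 := (unitNormal_mul_unitNormal hH pH qH hpq).trans
    (unitNormal_mul_unitNormal hC hp hq hpq).symm
  have e2 := (unitNormal_mul_unitNormal hH' sH tH hst).trans
    (unitNormal_mul_unitNormal hC hs ht hst).symm
  have e3 := congrArg conj ((unitNormal_mul_unitNormal hV tV pV htp).trans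
    (unitNormal_mul_unitNormal hC ht hp htp).symm)
  have e4 := congrArg conj ((unitNormal_mul_unitNormal hV' qV sV hqs).trans
    (unitNormal_mul_unitNormal hC hq hs hqs).symm)
  rw [map_mul, map_mul] at e3 e4
  have u1 := unitNormal_mul_conj hC hp
  have u2 := unitNormal_mul_conj hC hq
  have u3 := unitNormal_mul_conj hC hs
  have u4 := unitNormal_mul_conj hC ht
  calc _ = (unitNormal H p * unitNormal H q) * (unitNormal H' s * unitNormal H' t) *
        (conj (unitNormal V t) * conj (unitNormal V p)) *
        (conj (unitNormal V' q) * conj (unitNormal V' s)) := by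
        simp only [crossing]; ring
    _ = (unitNormal C p * conj (unitNormal C p)) * (unitNormal C q * conj (unitNormal C q)) *
        (unitNormal C s * conj (unitNormal C s)) * (unitNormal C t * conj (unitNormal C t)) := by
        rw [e1, e2, e3, e4]; ring
    _ = 1 := by rw [u1, u2, u3, u4]; norm_num

lemma int_const_of_succ {α : Type*} (f : ℤ → α) (h : ∀ j, f (j + 1) = f j) (j : ℤ) :
    f j = f 0 := by
  induction j using Int.induction_on with
  | zero => rfl
  | succ n ih => rw [h, ih]
  | pred n ih => rw [← ih, ← h]; congr 1; ring

/-- A lattice function of unit complex numbers whose product over every elementary square is `1`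
has real part of rank two. -/
lemma exists_re_eq_of_quad (z : ℤ → ℤ → ℂ) (hz : ∀ i j, z i j * conj (z i j) = 1)
    (h : ∀ i j, z i j * z (i + 1) j * z (i + 1) (j + 1) * z i (j + 1) = 1) :
    ∃ a₁ a₂ b₁ b₂ : ℤ → ℝ, (∀ i, a₁ i ^ 2 + a₂ i ^ 2 = 1) ∧ (∀ j, b₁ j ^ 2 + b₂ j ^ 2 = 1) ∧
      ∀ i j, (z i j).re = a₁ i * b₁ j + a₂ i * b₂ j := by
  -- For unit numbers conjugation is inversion: on one checkerboard colour it turns the relation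
  -- into `hq` without changing real parts.
  set y : ℤ → ℤ → ℂ := fun i j => if Even (i + j) then z i j else conj (z i j) with hy
  have hre : ∀ i j, (y i j).re = (z i j).re := by
    intro i j; simp only [hy]; split_ifs <;> simp
  have hu : ∀ i j, y i j * conj (y i j) = 1 := by
    intro i j
    simp only [hy]
    split_ifs
    · exact hz i j
    · rw [Complex.conj_conj, mul_comm]; exact hz i j
  have hq : ∀ i j, y i j * y (i + 1) (j + 1) = y (i + 1) j * y i (j + 1) := by
    intro i j
    have h0 := h i j
    have h1 := hz i j
    have h2 := hz (i + 1) j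
    have h3 := hz (i + 1) (j + 1)
    have h4 := hz i (j + 1)
    have key : z i j * z (i + 1) (j + 1) = conj (z (i + 1) j) * conj (z i (j + 1)) := by
      linear_combination conj (z (i + 1) j) * conj (z i (j + 1)) * h0
        - z i j * z (i + 1) (j + 1) * (z (i + 1) j * conj (z (i + 1) j)) * h4
        - z i j * z (i + 1) (j + 1) * h2
    have e1 : Even (i + 1 + (j + 1)) ↔ Even (i + j) := by grind
    have e2 : Even (i + 1 + j) ↔ ¬ Even (i + j) := by grind
    have e3 : Even (i + (j + 1)) ↔ ¬ Even (i + j) := by grind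
    simp only [hy, e1, e2, e3]
    by_cases he : Even (i + j)
    · simpa [he] using key
    · have := congrArg conj key
      simpa [he] using this
  have hne : ∀ i j, y i j ≠ 0 := by
    intro i j h0
    have := hu i j
    simp [h0] at this
  have s1 : ∀ i j, y (i + 1) j / y i j = y (i + 1) 0 / y i 0 := by
    intro i j
    refine int_const_of_succ (fun j => y (i + 1) j / y i j) (fun j => ?_) j
    rw [div_eq_div_iff (hne _ _) (hne _ _)]
    linear_combination hq i j
  have s2 : ∀ i j, y i j / y i 0 = y 0 j / y 0 0 := by
    intro i j
    refine int_const_of_succ (fun i => y i j / y i 0) (fun i => ?_) i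
    have := s1 i j
    change y (i + 1) j / y (i + 1) 0 = y i j / y i 0
    rw [div_eq_div_iff (hne _ _) (hne _ _)] at this ⊢
    linear_combination this
  have s3 : ∀ i j, y i j = (y i 0 * conj (y 0 0)) * y 0 j := by
    intro i j
    have := s2 i j
    rw [div_eq_div_iff (hne _ _) (hne _ _)] at this
    linear_combination conj (y 0 0) * this - y i j * hu 0 0
  have unit : ∀ w : ℂ, w * conj w = 1 → w.re ^ 2 + w.im ^ 2 = 1 := by
    intro w hw
    rw [Complex.mul_conj, Complex.normSq_apply] at hw
    have : w.re * w.re + w.im * w.im = 1 := by exact_mod_cast hw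
    linarith
  -- `Re (u w) = Re u Re w - Im u Im w`, whence the sign in `a₂`.
  refine ⟨fun i => (y i 0 * conj (y 0 0)).re, fun i => -(y i 0 * conj (y 0 0)).im,
    fun j => (y 0 j).re, fun j => (y 0 j).im, fun i => ?_, fun j => ?_, fun i j => ?_⟩
  · rw [neg_sq]
    apply unit
    rw [map_mul, Complex.conj_conj]
    linear_combination y 0 0 * conj (y 0 0) * hu i 0 + hu 0 0
  · exact unit _ (hu 0 j)
  · rw [← hre, s3, Complex.mul_re]
    ring

/-! ### The Möbius model -/

/-- The Lorentz product of the Möbius model, in the coordinates `(x, y, w, t)` in which the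
isotropic vectors are the multiples of `(x, y, 1, x² + y²)` and of `(0, 0, 0, 1)`. -/
noncomputable def lor (x y : Fin 4 → ℝ) : ℝ := x 0 * y 0 + x 1 * y 1 - (x 2 * y 3 + x 3 * y 2) / 2

lemma lor_comm (x y : Fin 4 → ℝ) : lor x y = lor y x := by simp only [lor]; ring

lemma lor_add_left (x y z : Fin 4 → ℝ) : lor (x + y) z = lor x z + lor y z := by
  simp only [lor, Pi.add_apply]; ring

lemma lor_sub_left (x y z : Fin 4 → ℝ) : lor (x - y) z = lor x z - lor y z := by
  simp only [lor, Pi.sub_apply]; ring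

lemma lor_smul_left (c : ℝ) (x y : Fin 4 → ℝ) : lor (c • x) y = c * lor x y := by
  simp only [lor, Pi.smul_apply, smul_eq_mul]; ring

lemma lor_add_right (x y z : Fin 4 → ℝ) : lor x (y + z) = lor x y + lor x z := by
  simp only [lor, Pi.add_apply]; ring

lemma lor_smul_right (c : ℝ) (x y : Fin 4 → ℝ) : lor x (c • y) = c * lor x y := by
  simp only [lor, Pi.smul_apply, smul_eq_mul]; ring

/-- The unit Lorentz vector of a circle. -/
noncomputable def unitVec (S : Sphere Plane) : Fin 4 → ℝ :=
  ![S.center 0 / S.radius, S.center 1 / S.radius, 1 / S.radius,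
    (S.center 0 ^ 2 + S.center 1 ^ 2 - S.radius ^ 2) / S.radius]

/-- For `k 2 = 1` the right side is half of `lor k k + R² - d²`, with `d` the distance from `(k 0, k
1)` to the centre: its vanishing means orthogonality, or incidence if `lor k k = 0`. -/
lemma radius_mul_lor_unitVec {S : Sphere Plane} (hS : S.radius ≠ 0) (k : Fin 4 → ℝ) :
    S.radius * lor k (unitVec S) = k 0 * S.center 0 + k 1 * S.center 1 -
      (k 2 * (S.center 0 ^ 2 + S.center 1 ^ 2 - S.radius ^ 2) + k 3) / 2 := by
  simp only [lor, unitVec, cons_val]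
  field_simp

lemma lor_unitVec_self {S : Sphere Plane} (hS : S.radius ≠ 0) : lor (unitVec S) (unitVec S) = 1 := by
  simp only [lor, unitVec, cons_val]
  field_simp
  ring

lemma lor_unitVec_unitVec {S T : Sphere Plane} (hS : S.radius ≠ 0) (hT : T.radius ≠ 0) {p : Plane}
    (h : p ∈ S) (h' : p ∈ T) : lor (unitVec S) (unitVec T) = (crossing S T p).re := by
  have h1 := crossing_re hS hT h h'
  rw [dist_sq] at h1
  have h2 : 2 * S.radius * T.radius * lor (unitVec S) (unitVec T) = S.radius ^ 2 + T.radius ^ 2 -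
      ((S.center 0 - T.center 0) ^ 2 + (S.center 1 - T.center 1) ^ 2) := by
    simp only [lor, unitVec, cons_val]
    field_simp
    ring
  have h3 : 2 * S.radius * T.radius ≠ 0 := by simp [hS, hT]
  exact mul_left_cancel₀ h3 (h2.trans h1.symm)

/-- The Gram matrix between the two families of circles of a circular net with circular parameter
lines has rank two. -/
lemma exists_lor_unitVec_eq {P : ℤ → ℤ → Plane} (hP : IsCircularNet P) {V H : ℤ → Sphere Plane}
    (hVr : ∀ i, 0 < (V i).radius) (hHr : ∀ j, 0 < (H j).radius)
    (hV : ∀ i j, P i j ∈ V i) (hH : ∀ i j, P i j ∈ H j) (gP : GenericVertices P) :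
    ∃ a₁ a₂ b₁ b₂ : ℤ → ℝ, (∀ i, a₁ i ^ 2 + a₂ i ^ 2 = 1) ∧ (∀ j, b₁ j ^ 2 + b₂ j ^ 2 = 1) ∧
      ∀ i j, lor (unitVec (V i)) (unitVec (H j)) = a₁ i * b₁ j + a₂ i * b₂ j := by
  obtain ⟨a₁, a₂, b₁, b₂, ha, hb, h⟩ := exists_re_eq_of_quad
    (fun i j => crossing (V i) (H j) (P i j))
    (fun i j => crossing_mul_conj (hVr i).ne' (hHr j).ne' (hV i j) (hH i j))
    (fun i j => crossing_quad (hVr i).ne' (hVr _).ne' (hHr j).ne' (hHr _).ne' (hP i j)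
      (hV _ _) (hV _ _) (hV _ _) (hV _ _) (hH _ _) (hH _ _) (hH _ _) (hH _ _)
      (gP.edge_fst _ _) (gP.edge_snd _ _) (gP.edge_fst _ _).symm (gP.edge_snd _ _).symm)
  exact ⟨a₁, a₂, b₁, b₂, ha, hb, fun i j =>
    (lor_unitVec_unitVec (hVr i).ne' (hHr j).ne' (hV i j) (hH i j)).trans (h i j)⟩

/-! ### The polar vectors of the two families -/

/-- The determinant of the first three coordinates. -/
def det₃ (x y z : Fin 4 → ℝ) : ℝ :=
  x 0 * (y 1 * z 2 - y 2 * z 1) - x 1 * (y 0 * z 2 - y 2 * z 0) + x 2 * (y 0 * z 1 - y 1 * z 0)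

lemma eq_zero_of_det₃_ne_zero {x y z : Fin 4 → ℝ} (h : det₃ x y z ≠ 0) {a b c : ℝ}
    (h0 : a * x 0 + b * x 1 + c * x 2 = 0) (h1 : a * y 0 + b * y 1 + c * y 2 = 0)
    (h2 : a * z 0 + b * z 1 + c * z 2 = 0) : a = 0 ∧ b = 0 ∧ c = 0 := by
  refine ⟨?_, ?_, ?_⟩ <;> refine (mul_eq_zero.mp ?_).resolve_left h <;> simp only [det₃]
  · linear_combination (y 1 * z 2 - y 2 * z 1) * h0 - (x 1 * z 2 - x 2 * z 1) * h1
      + (x 1 * y 2 - x 2 * y 1) * h2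
  · linear_combination -(y 0 * z 2 - y 2 * z 0) * h0 + (x 0 * z 2 - x 2 * z 0) * h1
      - (x 0 * y 2 - x 2 * y 0) * h2
  · linear_combination (y 0 * z 1 - y 1 * z 0) * h0 - (x 0 * z 1 - x 1 * z 0) * h1
      + (x 0 * y 1 - x 1 * y 0) * h2

lemma coeff_eq_zero_of_det₃_ne_zero {x y z : Fin 4 → ℝ} (h : det₃ x y z ≠ 0) {a b c : ℝ}
    (h0 : a • x + b • y + c • z = 0) : a = 0 ∧ b = 0 ∧ c = 0 := by
  have e0 := congrFun h0 0
  have e1 := congrFun h0 1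
  have e2 := congrFun h0 2
  simp only [Pi.add_apply, Pi.smul_apply, smul_eq_mul, Pi.zero_apply] at e0 e1 e2
  refine ⟨?_, ?_, ?_⟩ <;> refine (mul_eq_zero.mp ?_).resolve_left h <;> simp only [det₃]
  · linear_combination (y 1 * z 2 - y 2 * z 1) * e0 - (y 0 * z 2 - y 2 * z 0) * e1
      + (y 0 * z 1 - y 1 * z 0) * e2
  · linear_combination -(x 1 * z 2 - x 2 * z 1) * e0 + (x 0 * z 2 - x 2 * z 0) * e1
      - (x 0 * z 1 - x 1 * z 0) * e2
  · linear_combination (x 1 * y 2 - x 2 * y 1) * e0 - (x 0 * y 2 - x 2 * y 0) * e1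
      + (x 0 * y 1 - x 1 * y 0) * e2

/-- With `k 2 = 0` the last coordinates of `x, y, z` drop out, leaving a linear system with
determinant `det₃ x y z`. -/
lemma eq_zero_of_lor_eq_zero {x y z k : Fin 4 → ℝ} (h : det₃ x y z ≠ 0) (hx : lor k x = 0)
    (hy : lor k y = 0) (hz : lor k z = 0) (hk : k 2 = 0) : k = 0 := by
  simp only [lor, hk] at hx hy hz
  obtain ⟨h0, h1, h3⟩ := eq_zero_of_det₃_ne_zero (a := k 0) (b := k 1) (c := -(k 3) / 2) h
    (by linarith) (by linarith) (by linarith)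
  ext i
  fin_cases i
  · exact h0
  · exact h1
  · exact hk
  · change k 3 = 0
    linarith

lemma det_ne_zero_of_not_collinear {p q s : Plane} (h : ¬ Collinear ℝ ({p, q, s} : Set Plane)) :
    (q 0 - p 0) * (s 1 - p 1) - (q 1 - p 1) * (s 0 - p 0) ≠ 0 := by
  contrapose! h
  by_cases hpq : q = p
  · rw [hpq]
    simpa using collinear_pair ℝ p s
  rw [collinear_iff_of_mem (p₀ := p) (by simp)]
  have hn : (q 0 - p 0) ^ 2 + (q 1 - p 1) ^ 2 ≠ 0 := by
    rw [← dist_sq]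
    exact pow_ne_zero 2 (dist_ne_zero.mpr hpq)
  refine ⟨q - p, ?_⟩
  simp only [Set.mem_insert_iff, Set.mem_singleton_iff, forall_eq_or_imp, forall_eq]
  refine ⟨⟨0, by simp⟩, ⟨1, by simp⟩, ⟨((q 0 - p 0) * (s 0 - p 0) + (q 1 - p 1) * (s 1 - p 1)) /
    ((q 0 - p 0) ^ 2 + (q 1 - p 1) ^ 2), ?_⟩⟩
  ext i
  fin_cases i <;> simp <;> field_simp
  · linear_combination -(q 1 - p 1) * h
  · linear_combination (q 0 - p 0) * h

/-- The determinant is twice the signed area of the triangle of centres over the product of the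
radii. -/
lemma det₃_unitVec_ne_zero {S T U : Sphere Plane} (hS : S.radius ≠ 0) (hT : T.radius ≠ 0)
    (hU : U.radius ≠ 0)
    (h : ¬ Collinear ℝ ({S.center, T.center, U.center} : Set Plane)) :
    det₃ (unitVec S) (unitVec T) (unitVec U) ≠ 0 := by
  have h1 := det_ne_zero_of_not_collinear h
  have : det₃ (unitVec S) (unitVec T) (unitVec U) =
      ((T.center 0 - S.center 0) * (U.center 1 - S.center 1) -
      (T.center 1 - S.center 1) * (U.center 0 - S.center 0)) /
      (S.radius * T.radius * U.radius) := by
    simp only [det₃, unitVec, cons_val]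
    field_simp
    ring
  rw [this]
  exact div_ne_zero h1 (by simp [hS, hT, hU])

section Families

variable {v h : ℤ → Fin 4 → ℝ} {a₁ a₂ b₁ b₂ : ℤ → ℝ}

/-- Otherwise `a 1` and `a 2` are multiples of `a 0`, so `v i - c i • v 0` is orthogonal to all `h
j` for `i = 1, 2`. That complement is at most a line, which makes `v 0, v 1, v 2` dependent. -/
lemma cross_ne_zero_or (dv : det₃ (v 0) (v 1) (v 2) ≠ 0) (dh : det₃ (h 0) (h 1) (h 2) ≠ 0)
    (ha : ∀ i, a₁ i ^ 2 + a₂ i ^ 2 = 1)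
    (hg : ∀ i j, lor (v i) (h j) = a₁ i * b₁ j + a₂ i * b₂ j) :
    a₁ 0 * a₂ 1 - a₂ 0 * a₁ 1 ≠ 0 ∨ a₁ 0 * a₂ 2 - a₂ 0 * a₁ 2 ≠ 0 := by
  by_contra! hc
  set c : ℤ → ℝ := fun i => a₁ 0 * a₁ i + a₂ 0 * a₂ i with hcdef
  have hp : ∀ i, a₁ 0 * a₂ i - a₂ 0 * a₁ i = 0 → ∀ j, lor (v i - c i • v 0) (h j) = 0 := by
    intro i hi j
    rw [lor_sub_left, lor_smul_left, hg, hg]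
    simp only [hcdef]
    linear_combination (-a₁ i * b₁ j - a₂ i * b₂ j) * ha 0 + (a₁ 0 * b₂ j - a₂ 0 * b₁ j) * hi
  have hp1 := hp 1 hc.1
  have hp2 := hp 2 hc.2
  set w : ℤ → ℝ := fun i => (v i - c i • v 0) 2 with hw
  have hz : w 2 • (v 1 - c 1 • v 0) - w 1 • (v 2 - c 2 • v 0) = 0 := by
    apply eq_zero_of_lor_eq_zero dh <;>
      first
      | rw [lor_sub_left, lor_smul_left, lor_smul_left, hp1, hp2]; ring
      | simp only [hw, Pi.sub_apply, Pi.smul_apply, smul_eq_mul]; ring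
  have hz' : (w 1 * c 2 - w 2 * c 1) • v 0 + w 2 • v 1 + (-w 1) • v 2 = 0 := by
    rw [← hz]; module
  have hw1 : w 1 = 0 := by linarith [(coeff_eq_zero_of_det₃_ne_zero dv hz').2.2]
  have h3 : (-c 1) • v 0 + (1 : ℝ) • v 1 + (0 : ℝ) • v 2 = 0 := by
    rw [← eq_zero_of_lor_eq_zero dh (hp1 0) (hp1 1) (hp1 2) hw1]; module
  exact one_ne_zero (coeff_eq_zero_of_det₃_ne_zero dv h3).2.1

/-- There is a vector in the span of the `v i` which is orthogonal to all `h j`. -/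
lemma exists_polar (dv : det₃ (v 0) (v 1) (v 2) ≠ 0) (dh : det₃ (h 0) (h 1) (h 2) ≠ 0)
    (ha : ∀ i, a₁ i ^ 2 + a₂ i ^ 2 = 1)
    (hg : ∀ i j, lor (v i) (h j) = a₁ i * b₁ j + a₂ i * b₂ j) :
    ∃ k : Fin 4 → ℝ, k 2 = 1 ∧ (∀ j, lor k (h j) = 0) ∧
      ∀ x, (∀ i, lor x (v i) = 0) → lor x k = 0 := by
  -- The coefficients are the linear relation between the plane vectors `a 0, a 1, a 2`.
  set k := (a₁ 1 * a₂ 2 - a₂ 1 * a₁ 2) • v 0 + (-(a₁ 0 * a₂ 2 - a₂ 0 * a₁ 2)) • v 1 +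
    (a₁ 0 * a₂ 1 - a₂ 0 * a₁ 1) • v 2 with hk
  have hkh : ∀ j, lor k (h j) = 0 := fun j => by
    simp only [hk, lor_add_left, lor_smul_left, hg]; ring
  have hk2 : k 2 ≠ 0 := by
    intro h0
    have h1 := eq_zero_of_lor_eq_zero dh (hkh 0) (hkh 1) (hkh 2) h0
    obtain ⟨-, e1, e2⟩ := coeff_eq_zero_of_det₃_ne_zero dv (hk.symm.trans h1)
    rcases cross_ne_zero_or dv dh ha hg with h2 | h2
    · exact h2 e2
    · exact h2 (by linarith)
  refine ⟨(k 2)⁻¹ • k, by simp [hk2], fun j => ?_, fun x hx => ?_⟩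
  · rw [lor_smul_left, hkh, mul_zero]
  · rw [lor_smul_right, hk]
    simp only [lor_add_right, lor_smul_right, hx]
    ring

lemma eq_smul_of_lor_eq_zero (dh : det₃ (h 0) (h 1) (h 2) ≠ 0) {k x : Fin 4 → ℝ} (hk2 : k 2 = 1)
    (hk : ∀ j, lor k (h j) = 0) (hx : ∀ j, lor x (h j) = 0) : x = x 2 • k := by
  rw [← sub_eq_zero]
  apply eq_zero_of_lor_eq_zero dh
  · rw [lor_sub_left, lor_smul_left, hx, hk]; ring
  · rw [lor_sub_left, lor_smul_left, hx, hk]; ring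
  · rw [lor_sub_left, lor_smul_left, hx, hk]; ring
  · simp [hk2]

/-! ### The adapted orthogonal frame -/

/-- Rotating by half the argument of `z` diagonalises the Gram matrix. A rotation is used because it
preserves `a₁² + a₂² = 1`. -/
lemma exists_rotation (x y : Fin 4 → ℝ) :
    ∃ c s : ℝ, c ^ 2 + s ^ 2 = 1 ∧ lor (c • x + s • y) ((-s) • x + c • y) = 0 := by
  set z : ℂ := ⟨(lor x x - lor y y) / 2, lor x y⟩ with hz
  have h1 : ‖z‖ * Real.cos z.arg = (lor x x - lor y y) / 2 := Complex.norm_mul_cos_arg z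
  have h2 : ‖z‖ * Real.sin z.arg = lor x y := Complex.norm_mul_sin_arg z
  have harg : z.arg = 2 * (z.arg / 2) := by ring
  rw [harg, Real.cos_two_mul'] at h1
  rw [harg, Real.sin_two_mul] at h2
  refine ⟨Real.cos (z.arg / 2), Real.sin (z.arg / 2), Real.cos_sq_add_sin_sq _, ?_⟩
  simp only [lor_add_left, lor_smul_left, lor_add_right, lor_smul_right, lor_comm y x]
  linear_combination
    (2 * Real.cos (z.arg / 2) * Real.sin (z.arg / 2)) * h1 -
    (Real.cos (z.arg / 2) ^ 2 - Real.sin (z.arg / 2) ^ 2) * h2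

/-- Two families of unit vectors of the Möbius model together with an orthogonal basis
`g₁, g₂, k, l` to which they are adapted: the first family lies in the span of `g₁, g₂, k` and the
second one in the span of `g₁, g₂, l`, with dual coordinates along `g₁` and `g₂`. -/
structure IsAdaptedFrame (v h : ℤ → Fin 4 → ℝ) (a₁ a₂ s b₁ b₂ t : ℤ → ℝ)
    (g₁ g₂ k l : Fin 4 → ℝ) : Prop where
  k_two : k 2 = 1
  l_two : l 2 = 1
  k_l : lor k l = 0
  g₁_g₂ : lor g₁ g₂ = 0
  g₁_k : lor g₁ k = 0
  g₂_k : lor g₂ k = 0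
  g₁_l : lor g₁ l = 0
  g₂_l : lor g₂ l = 0
  k_k : lor k k ≠ 0
  l_l : lor l l ≠ 0
  g₁_g₁ : lor g₁ g₁ ≠ 0
  g₂_g₂ : lor g₂ g₂ ≠ 0
  k_h : ∀ j, lor k (h j) = 0
  l_v : ∀ i, lor l (v i) = 0
  a_unit : ∀ i, a₁ i ^ 2 + a₂ i ^ 2 = 1
  b_unit : ∀ j, b₁ j ^ 2 + b₂ j ^ 2 = 1
  v_eq : ∀ i, v i = (a₁ i / lor g₁ g₁) • g₁ + (a₂ i / lor g₂ g₂) • g₂ + s i • k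
  h_eq : ∀ j, h j = b₁ j • g₁ + b₂ j • g₂ + t j • l

lemma exists_isAdaptedFrame (dv : det₃ (v 0) (v 1) (v 2) ≠ 0)
    (dh : det₃ (h 0) (h 1) (h 2) ≠ 0)
    (ha : ∀ i, a₁ i ^ 2 + a₂ i ^ 2 = 1) (hb : ∀ j, b₁ j ^ 2 + b₂ j ^ 2 = 1)
    (hg : ∀ i j, lor (v i) (h j) = a₁ i * b₁ j + a₂ i * b₂ j)
    (nv : ∀ k : Fin 4 → ℝ, k 2 = 1 → (∀ i, lor k (v i) = 0) → lor k k ≠ 0)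
    (nh : ∀ k : Fin 4 → ℝ, k 2 = 1 → (∀ j, lor k (h j) = 0) → lor k k ≠ 0) :
    ∃ (a₁ a₂ s b₁ b₂ t : ℤ → ℝ) (g₁ g₂ k l : Fin 4 → ℝ),
      IsAdaptedFrame v h a₁ a₂ s b₁ b₂ t g₁ g₂ k l := by
  have hg' : ∀ j i, lor (h j) (v i) = b₁ j * a₁ i + b₂ j * a₂ i := fun j i => by
    rw [lor_comm, hg]; ring
  obtain ⟨k, k_two, k_h, k_v⟩ := exists_polar dv dh ha hg
  obtain ⟨l, l_two, l_v, -⟩ := exists_polar dh dv hb hg'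
  have k_k := nh k k_two k_h
  have l_l := nv l l_two l_v
  have l_k : lor l k = 0 := k_v l l_v
  have k_l : lor k l = 0 := by rw [lor_comm, l_k]
  obtain ⟨j, hj⟩ : ∃ j, b₁ 0 * b₂ j - b₂ 0 * b₁ j ≠ 0 := by
    rcases cross_ne_zero_or dh dv hb hg' with h0 | h0 <;> exact ⟨_, h0⟩
  obtain ⟨i, hi⟩ : ∃ i, a₁ 0 * a₂ i - a₂ 0 * a₁ i ≠ 0 := by
    rcases cross_ne_zero_or dv dh ha hg with h0 | h0 <;> exact ⟨_, h0⟩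
  have dual : ∀ p q : ℝ, ∃ g : Fin 4 → ℝ, (∀ i, lor g (v i) = p * a₁ i + q * a₂ i) ∧
      lor g k = 0 ∧ lor g l = 0 := by
    intro p q
    -- Cramer's rule for writing `(p, q)` in terms of `b 0` and `b j`; removing the `l`-component
    -- keeps the products with `v i`.
    set d := b₁ 0 * b₂ j - b₂ 0 * b₁ j with hd
    set g := ((p * b₂ j - q * b₁ j) / d) • h 0 + ((q * b₁ 0 - p * b₂ 0) / d) • h j
    refine ⟨g - (lor g l / lor l l) • l, fun i => ?_, ?_, ?_⟩
    · rw [lor_sub_left, lor_smul_left, l_v, lor_add_left, lor_smul_left, lor_smul_left, hg', hg']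
      field_simp
      rw [hd]
      ring
    · rw [lor_sub_left, lor_smul_left, l_k, lor_add_left, lor_smul_left, lor_smul_left,
        lor_comm _ k, lor_comm _ k, k_h, k_h]
      ring
    · rw [lor_sub_left, lor_smul_left]
      field_simp
      ring
  obtain ⟨x, x_v, x_k, x_l⟩ := dual 1 0
  obtain ⟨y, y_v, y_k, y_l⟩ := dual 0 1
  obtain ⟨c, r, hcr, hxy⟩ := exists_rotation x y
  set g₁ := c • x + r • y with hg₁
  set g₂ := (-r) • x + c • y with hg₂
  have g₁_v : ∀ i, lor g₁ (v i) = c * a₁ i + r * a₂ i := fun i => by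
    rw [hg₁, lor_add_left, lor_smul_left, lor_smul_left, x_v, y_v]; ring
  have g₂_v : ∀ i, lor g₂ (v i) = -r * a₁ i + c * a₂ i := fun i => by
    rw [hg₂, lor_add_left, lor_smul_left, lor_smul_left, x_v, y_v]; ring
  have g₁_k : lor g₁ k = 0 := by
    rw [hg₁, lor_add_left, lor_smul_left, lor_smul_left, x_k, y_k]; ring
  have g₂_k : lor g₂ k = 0 := by
    rw [hg₂, lor_add_left, lor_smul_left, lor_smul_left, x_k, y_k]; ring
  have g₁_l : lor g₁ l = 0 := by
    rw [hg₁, lor_add_left, lor_smul_left, lor_smul_left, x_l, y_l]; ring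
  have g₂_l : lor g₂ l = 0 := by
    rw [hg₂, lor_add_left, lor_smul_left, lor_smul_left, x_l, y_l]; ring
  -- The remainder is orthogonal to every `v i`, hence a multiple of `l`.
  have h_eq : ∀ j, ∃ t : ℝ,
      h j = (c * b₁ j + r * b₂ j) • g₁ + (-r * b₁ j + c * b₂ j) • g₂ + t • l := by
    intro j
    have := eq_smul_of_lor_eq_zero dv l_two l_v
      (x := h j - (c * b₁ j + r * b₂ j) • g₁ - (-r * b₁ j + c * b₂ j) • g₂) (fun i => by
        rw [lor_sub_left, lor_sub_left, lor_smul_left, lor_smul_left, g₁_v, g₂_v, hg']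
        linear_combination -(b₁ j * a₁ i + b₂ j * a₂ i) * hcr)
    exact ⟨_, sub_eq_iff_eq_add'.mp ((sub_sub _ _ _).symm.trans this)⟩
  choose t h_eq using h_eq
  have g₁_h : ∀ j, lor g₁ (h j) = (c * b₁ j + r * b₂ j) * lor g₁ g₁ := fun j => by
    rw [h_eq, lor_add_right, lor_add_right, lor_smul_right, lor_smul_right, lor_smul_right, hxy,
      g₁_l]
    ring
  have g₂_h : ∀ j, lor g₂ (h j) = (-r * b₁ j + c * b₂ j) * lor g₂ g₂ := fun j => by
    rw [h_eq, lor_add_right, lor_add_right, lor_smul_right, lor_smul_right, lor_smul_right,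
      lor_comm g₂ g₁, hxy, g₂_l]
    ring
  have eq_zero : ∀ g : Fin 4 → ℝ, lor g k = 0 → (∀ j, lor g (h j) = 0) → g = 0 := by
    intro g hgk hgh
    have e := eq_smul_of_lor_eq_zero dh k_two k_h hgh
    rw [e, lor_smul_left] at hgk
    rw [e, (mul_eq_zero.mp hgk).resolve_right k_k, zero_smul]
  -- An isotropic `g₁` would be orthogonal to `k` and all `h j`, hence zero; then every `a i` would
  -- be orthogonal to `(c, r)`.
  have g₁_g₁ : lor g₁ g₁ ≠ 0 := by
    intro h0
    have := eq_zero g₁ g₁_k (fun j => by rw [g₁_h, h0, mul_zero])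
    have e : ∀ i, c * a₁ i + r * a₂ i = 0 := fun i => by
      rw [← g₁_v, this]; simp [lor]
    apply hi
    linear_combination -(a₁ 0 * a₂ i - a₂ 0 * a₁ i) * hcr + (c * a₂ i - r * a₁ i) * e 0
      - (c * a₂ 0 - r * a₁ 0) * e i
  have g₂_g₂ : lor g₂ g₂ ≠ 0 := by
    intro h0
    have := eq_zero g₂ g₂_k (fun j => by rw [g₂_h, h0, mul_zero])
    have e : ∀ i, -r * a₁ i + c * a₂ i = 0 := fun i => by
      rw [← g₂_v, this]; simp [lor]
    apply hi
    linear_combination -(a₁ 0 * a₂ i - a₂ 0 * a₁ i) * hcr - (r * a₂ i + c * a₁ i) * e 0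
      + (r * a₂ 0 + c * a₁ 0) * e i
  have v_eq : ∀ i, ∃ s : ℝ, v i = ((c * a₁ i + r * a₂ i) / lor g₁ g₁) • g₁ +
      ((-r * a₁ i + c * a₂ i) / lor g₂ g₂) • g₂ + s • k := by
    intro i
    have := eq_smul_of_lor_eq_zero dh k_two k_h
      (x := v i - ((c * a₁ i + r * a₂ i) / lor g₁ g₁) • g₁ -
        ((-r * a₁ i + c * a₂ i) / lor g₂ g₂) • g₂) (fun j => by
        rw [lor_sub_left, lor_sub_left, lor_smul_left, lor_smul_left, g₁_h, g₂_h, hg]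
        field_simp
        linear_combination -(a₁ i * b₁ j + a₂ i * b₂ j) * hcr)
    exact ⟨_, sub_eq_iff_eq_add'.mp ((sub_sub _ _ _).symm.trans this)⟩
  choose s v_eq using v_eq
  exact ⟨_, _, s, _, _, t, g₁, g₂, k, l,
    { k_two, l_two, k_l, g₁_g₂ := hxy, g₁_k, g₂_k, g₁_l, g₂_l, k_k, l_l, g₁_g₁, g₂_g₂, k_h, l_v,
      v_eq, h_eq
      a_unit := fun i => by linear_combination (a₁ i ^ 2 + a₂ i ^ 2) * hcr + ha i
      b_unit := fun j => by linear_combination (b₁ j ^ 2 + b₂ j ^ 2) * hcr + hb j }⟩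

end Families

/-! ### The conics of the centres -/

/-- A diagonal ternary quadratic form with nonzero last coefficient that vanishes at five points in
general position has nonzero first coefficient. -/
lemma coeff_ne_zero_of_five_points {x y z : ℤ → ℝ} {d₁ d₂ d₃ : ℝ} (h3 : d₃ ≠ 0)
    (hq : ∀ j, d₁ * x j ^ 2 + d₂ * y j ^ 2 + d₃ * z j ^ 2 = 0)
    (hd : ∀ i j k : ℤ, i < j → j < k → k ≤ i + 4 →
      x i * (y j * z k - z j * y k) - y i * (x j * z k - z j * x k)
        + z i * (x j * y k - y j * x k) ≠ 0) : d₁ ≠ 0 := by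
  intro h1
  have hz : ∀ j, z j ^ 2 = -d₂ / d₃ * y j ^ 2 := fun j => by
    have := hq j
    rw [h1] at this
    field_simp
    linarith
  rcases lt_or_ge (-d₂ / d₃) 0 with he | he
  · have hy0 : ∀ j, y j = 0 := fun j => by
      have := hz j
      by_contra h0
      have : 0 < y j ^ 2 := by positivity
      nlinarith [sq_nonneg (z j)]
    have hz0 : ∀ j, z j = 0 := fun j => by
      have := hz j
      rw [hy0 j] at this
      simpa using this
    exact hd 0 1 2 (by norm_num) (by norm_num) (by norm_num) (by simp [hy0, hz0])
  · obtain ⟨e, hee⟩ : ∃ e, e ^ 2 = -d₂ / d₃ := ⟨_, Real.sq_sqrt he⟩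
    -- The form splits into two lines; by pigeonhole three of the indices `0, …, 4` lie on one of
    -- them.
    have hs : ∀ j, z j = e * y j ∨ z j = -e * y j := fun j => by
      rw [neg_mul]
      apply sq_eq_sq_iff_eq_or_eq_neg.mp
      rw [hz, mul_pow, hee]
    have key : ∀ (f : ℝ) (i j k : ℤ), i < j → j < k → k ≤ i + 4 → z i = f * y i → z j = f * y j →
        z k = f * y k → False := by
      intro f i j k hij hjk hki ei ej ek
      apply hd i j k hij hjk hki
      rw [ei, ej, ek]
      ring
    have k012 := fun f => key f 0 1 2 (by norm_num) (by norm_num) (by norm_num)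
    have k013 := fun f => key f 0 1 3 (by norm_num) (by norm_num) (by norm_num)
    have k014 := fun f => key f 0 1 4 (by norm_num) (by norm_num) (by norm_num)
    have k023 := fun f => key f 0 2 3 (by norm_num) (by norm_num) (by norm_num)
    have k024 := fun f => key f 0 2 4 (by norm_num) (by norm_num) (by norm_num)
    have k034 := fun f => key f 0 3 4 (by norm_num) (by norm_num) (by norm_num)
    have k123 := fun f => key f 1 2 3 (by norm_num) (by norm_num) (by norm_num)
    have k124 := fun f => key f 1 2 4 (by norm_num) (by norm_num) (by norm_num)
    have k134 := fun f => key f 1 3 4 (by norm_num) (by norm_num) (by norm_num)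
    have k234 := fun f => key f 2 3 4 (by norm_num) (by norm_num) (by norm_num)
    rcases hs 0 with h0 | h0 <;> rcases hs 1 with h1 | h1 <;> rcases hs 2 with h2 | h2 <;>
      rcases hs 3 with h3 | h3 <;> rcases hs 4 with h4 | h4 <;>
      first
      | exact k012 _ h0 h1 h2
      | exact k013 _ h0 h1 h3
      | exact k014 _ h0 h1 h4
      | exact k023 _ h0 h2 h3
      | exact k024 _ h0 h2 h4
      | exact k034 _ h0 h3 h4
      | exact k123 _ h1 h2 h3
      | exact k124 _ h1 h2 h4
      | exact k134 _ h1 h3 h4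
      | exact k234 _ h2 h3 h4

/-- The matrix whose columns are the first three coordinates of three vectors. -/
def colMat (x y z : Fin 4 → ℝ) : Matrix (Fin 3) (Fin 3) ℝ :=
  !![x 0, y 0, z 0; x 1, y 1, z 1; x 2, y 2, z 2]

lemma det_colMat (x y z : Fin 4 → ℝ) : (colMat x y z).det = det₃ x y z := by
  simp only [colMat, det_fin_three, det₃, of_apply, cons_val]
  ring

/-- The conic with a given diagonal form with respect to a projective coordinate system. -/
noncomputable def Conic.ofDiagonal (X : Matrix (Fin 3) (Fin 3) ℝ) (hX : X.det ≠ 0)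
    (d : Fin 3 → ℝ) (hd : ∀ i, d i ≠ 0) : Conic where
  mat := X⁻¹ᵀ * diagonal d * X⁻¹
  isSymm := by
    simp [IsSymm, Matrix.mul_assoc]
  det_ne_zero := by
    rw [det_mul, det_mul, det_transpose, det_diagonal]
    have : X⁻¹.det ≠ 0 := by
      rw [det_nonsing_inv, Ring.inverse_eq_inv']
      exact inv_ne_zero hX
    exact mul_ne_zero (mul_ne_zero this (Finset.prod_ne_zero_iff.mpr fun i _ => hd i)) this

lemma Conic.dualMat_ofDiagonal (X : Matrix (Fin 3) (Fin 3) ℝ) (hX : X.det ≠ 0)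
    (d : Fin 3 → ℝ) (hd : ∀ i, d i ≠ 0) :
    (Conic.ofDiagonal X hX d hd).dualMat = X * diagonal d⁻¹ * Xᵀ := by
  have hu : IsUnit X.det := hX.isUnit
  have hut : IsUnit Xᵀ.det := by rwa [det_transpose]
  have hdd : diagonal d * diagonal d⁻¹ = 1 := by
    rw [diagonal_mul_diagonal, ← diagonal_one]
    congr 1
    funext i
    simp [hd i]
  apply inv_eq_right_inv
  calc X⁻¹ᵀ * diagonal d * X⁻¹ * (X * diagonal d⁻¹ * Xᵀ)
      = X⁻¹ᵀ * (diagonal d * (X⁻¹ * X) * diagonal d⁻¹) * Xᵀ := by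
        simp only [Matrix.mul_assoc]
    _ = 1 := by
        rw [nonsing_inv_mul X hu, Matrix.mul_one, hdd, Matrix.mul_one, transpose_nonsing_inv,
          nonsing_inv_mul Xᵀ hut]

lemma Conic.contains_ofDiagonal {X : Matrix (Fin 3) (Fin 3) ℝ} (hX : X.det ≠ 0)
    {d : Fin 3 → ℝ} (hd : ∀ i, d i ≠ 0) {p : Plane} (u : Fin 3 → ℝ) {c : ℝ}
    (hp : homog p = c • (X *ᵥ u)) (hu : ∑ i, d i * u i ^ 2 = 0) :
    (Conic.ofDiagonal X hX d hd).Contains p := by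
  have hq : X⁻¹ *ᵥ (X *ᵥ u) = u := by
    rw [mulVec_mulVec, nonsing_inv_mul X hX.isUnit, one_mulVec]
  have : (X *ᵥ u) ⬝ᵥ ((Conic.ofDiagonal X hX d hd).mat *ᵥ (X *ᵥ u)) = 0 := by
    rw [Conic.ofDiagonal, ← mulVec_mulVec, hq, ← mulVec_mulVec, dotProduct_mulVec,
      vecMul_transpose, hq, ← hu]
    simp only [dotProduct, mulVec_diagonal]
    exact Finset.sum_congr rfl fun i _ => by ring
  rw [Conic.Contains, hp, mulVec_smul, smul_dotProduct, dotProduct_smul, this, smul_zero,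
    smul_zero]

/-- `absoluteDual` is singular and `Q₁.dualMat` is not, so they span a genuine pencil. -/
lemma Conic.confocal_of_add_eq {Q₁ Q₂ : Conic} (h : Q₁.dualMat + Q₂.dualMat = -absoluteDual) :
    Q₁.Confocal Q₂ := by
  have hli : LinearIndependent ℝ ![absoluteDual, Q₁.dualMat] := by
    have hdet : Q₁.dualMat.det ≠ 0 := by
      rw [Conic.dualMat, det_nonsing_inv, Ring.inverse_eq_inv']
      exact inv_ne_zero Q₁.det_ne_zero
    rw [LinearIndependent.pair_iff]
    intro s t hst
    have ht : t = 0 := by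
      by_contra ht
      have h1 : t • Q₁.dualMat = (-s) • absoluteDual := by
        rw [neg_smul, eq_neg_iff_add_eq_zero, add_comm, hst]
      have h2 := congrArg Matrix.det h1
      rw [det_smul, det_smul] at h2
      have h3 : absoluteDual.det = 0 := by simp [absoluteDual, det_fin_three]
      rw [h3, mul_zero] at h2
      exact mul_ne_zero (pow_ne_zero _ ht) hdet h2
    refine ⟨?_, ht⟩
    have := congrFun (congrFun hst 0) 0
    simpa [ht, absoluteDual] using this
  refine ⟨Submodule.span ℝ (Set.range ![absoluteDual, Q₁.dualMat]), ?_,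
    Submodule.subset_span ⟨0, rfl⟩, Submodule.subset_span ⟨1, rfl⟩, ?_⟩
  · rw [finrank_span_eq_card hli, Fintype.card_fin]
  · rw [← eq_sub_iff_add_eq'] at h
    rw [h]
    exact Submodule.sub_mem _ (Submodule.neg_mem _ (Submodule.subset_span ⟨0, rfl⟩))
      (Submodule.subset_span ⟨1, rfl⟩)

/-- The inverse Lorentz form, expressed by an orthogonal basis. -/
lemma sum_orthogonal_basis {g₁ g₂ k l : Fin 4 → ℝ} (k_l : lor k l = 0) (g₁_g₂ : lor g₁ g₂ = 0)
    (g₁_k : lor g₁ k = 0) (g₂_k : lor g₂ k = 0) (g₁_l : lor g₁ l = 0) (g₂_l : lor g₂ l = 0)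
    (k_k : lor k k ≠ 0) (l_l : lor l l ≠ 0) (g₁_g₁ : lor g₁ g₁ ≠ 0) (g₂_g₂ : lor g₂ g₂ ≠ 0)
    (a b : Fin 4) :
    g₁ a * g₁ b / lor g₁ g₁ + g₂ a * g₂ b / lor g₂ g₂ + k a * k b / lor k k +
      l a * l b / lor l l =
      !![1, 0, 0, 0; 0, 1, 0, 0; 0, 0, 0, -2; 0, 0, -2, (0 : ℝ)] a b := by
  set e : Fin 4 → Fin 4 → ℝ := ![g₁, g₂, k, l] with he
  set J : Matrix (Fin 4) (Fin 4) ℝ := !![1, 0, 0, 0; 0, 1, 0, 0; 0, 0, 0, -1/2; 0, 0, -1/2, 0]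
  set J' : Matrix (Fin 4) (Fin 4) ℝ := !![1, 0, 0, 0; 0, 1, 0, 0; 0, 0, 0, -2; 0, 0, -2, 0]
  set X : Matrix (Fin 4) (Fin 4) ℝ := of e
  set D : Matrix (Fin 4) (Fin 4) ℝ := diagonal fun i => (lor (e i) (e i))⁻¹
  have hJJ : J * J' = 1 := by
    ext i j
    fin_cases i <;> fin_cases j <;>
      simp [J, J', mul_apply, Fin.sum_univ_four, one_apply]
  have hlor : ∀ i j, (X * J * Xᵀ) i j = lor (e i) (e j) := fun i j => by
    simp [X, J, mul_apply, Fin.sum_univ_four, lor]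
    ring
  -- Orthogonality of the rows of `X`; cyclically moving factors then gives `Xᵀ * D * X = J⁻¹`.
  have h1 : X * J * Xᵀ * D = 1 := by
    ext i j
    rw [mul_diagonal, hlor]
    have c1 := (lor_comm l k).trans k_l
    have c2 := (lor_comm g₂ g₁).trans g₁_g₂
    have c3 := (lor_comm k g₁).trans g₁_k
    have c4 := (lor_comm k g₂).trans g₂_k
    have c5 := (lor_comm l g₁).trans g₁_l
    have c6 := (lor_comm l g₂).trans g₂_l
    fin_cases i <;> fin_cases j <;>
      simp [he, k_l, g₁_g₂, g₁_k, g₂_k, g₁_l, g₂_l, k_k, l_l, g₁_g₁, g₂_g₂, c1, c2, c3, c4, c5, c6]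
  have h2 : (J * Xᵀ * D) * X = 1 := by
    rw [mul_eq_one_comm]
    simpa only [Matrix.mul_assoc] using h1
  have h3 : Xᵀ * D * X = J' := by
    have hJ'J : J' * J = 1 := mul_eq_one_comm.mp hJJ
    calc Xᵀ * D * X = (J' * J) * (Xᵀ * D * X) := by rw [hJ'J, Matrix.one_mul]
      _ = J' * (J * Xᵀ * D * X) := by simp only [Matrix.mul_assoc]
      _ = J' := by rw [h2, Matrix.mul_one]
  rw [← h3, mul_apply]
  simp only [X, D, he, mul_diagonal, transpose_apply, of_apply, Fin.sum_univ_four,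
    cons_val]
  ring

/-- An isotropic `k` represents a point, which would lie on all the circles. -/
lemma lor_self_ne_zero_of_generic {S : ℤ → Sphere Plane} (hr : ∀ i, 0 < (S i).radius)
    (gS : GenericCircles S) (k : Fin 4 → ℝ) (hk : k 2 = 1)
    (h : ∀ i, lor k (unitVec (S i)) = 0) : lor k k ≠ 0 := by
  intro h0
  have hmem : ∀ i, (!₂[k 0, k 1] : Plane) ∈ S i := by
    intro i
    have h1 := radius_mul_lor_unitVec (hr i).ne' k
    rw [h, hk] at h1
    simp only [lor, hk] at h0
    rw [EuclideanGeometry.mem_sphere, ← sq_eq_sq₀ dist_nonneg (hr i).le, dist_sq]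
    simp
    linarith
  exact gS.no_common_point 0 _ ⟨hmem 0, hmem (0 + 1), hmem (0 + 2)⟩

/-- The circle represented by a Lorentz vector. -/
noncomputable def genCircleOf (k : Fin 4 → ℝ) (hk : lor k k ≠ 0) : GenCircle where
  center := !₂[k 0, k 1]
  sqRadius := lor k k
  sqRadius_ne_zero := hk

lemma genCircleOf_orthogonal_ofSphere {k : Fin 4 → ℝ} (hk : lor k k ≠ 0) (hk2 : k 2 = 1)
    {S : Sphere Plane} (hS : 0 < S.radius) (h : lor k (unitVec S) = 0) :
    (genCircleOf k hk).Orthogonal (GenCircle.ofSphere S hS) := by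
  have h1 := radius_mul_lor_unitVec hS.ne' k
  rw [h, hk2] at h1
  rw [GenCircle.Orthogonal, dist_sq]
  simp [genCircleOf, GenCircle.ofSphere, lor, hk2]
  linarith

lemma genCircleOf_orthogonal {k l : Fin 4 → ℝ} (hk : lor k k ≠ 0) (hl : lor l l ≠ 0)
    (hk2 : k 2 = 1) (hl2 : l 2 = 1) (h : lor k l = 0) :
    (genCircleOf k hk).Orthogonal (genCircleOf l hl) := by
  rw [GenCircle.Orthogonal, dist_sq]
  simp only [lor, hk2, hl2] at h
  simp [genCircleOf, lor, hk2, hl2]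
  linarith

lemma det₃_combination (x y z : Fin 4 → ℝ) (a b c : Fin 3 → ℝ) :
    det₃ (a 0 • x + a 1 • y + a 2 • z) (b 0 • x + b 1 • y + b 2 • z)
      (c 0 • x + c 1 • y + c 2 • z) =
    det₃ x y z * (a 0 * (b 1 * c 2 - b 2 * c 1) - a 1 * (b 0 * c 2 - b 2 * c 0)
      + a 2 * (b 0 * c 1 - b 1 * c 0)) := by
  simp only [det₃, Pi.add_apply, Pi.smul_apply, smul_eq_mul]
  ring

/-- The first three coordinates of `unitVec S` are those of the centre divided by the radius, so
Lorentz coordinates descend to projective ones. -/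
lemma homog_center_eq {S : Sphere Plane} (hS : S.radius ≠ 0) {x y z : Fin 4 → ℝ} {a b c : ℝ}
    (h : unitVec S = a • x + b • y + c • z) :
    homog S.center = S.radius • (colMat x y z *ᵥ ![a, b, c]) := by
  have e : ∀ i, unitVec S i = a * x i + b * y i + c * z i := fun i => congrFun h i
  have h0 := e 0
  have h1 := e 1
  have h2 := e 2
  simp only [unitVec, cons_val] at h0 h1 h2
  field_simp at h0 h1 h2
  ext i
  fin_cases i <;> simp [homog, colMat] <;> linarith

lemma colMat_mul_diagonal_mul_apply (x y z : Fin 4 → ℝ) (a b c : ℝ) (i j : Fin 3) :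
    (colMat x y z * diagonal ![a, b, c]⁻¹ * (colMat x y z)ᵀ) i j =
      x i.castSucc * a⁻¹ * x j.castSucc + y i.castSucc * b⁻¹ * y j.castSucc
        + z i.castSucc * c⁻¹ * z j.castSucc := by
  have hc : ∀ i, colMat x y z i = ![x i.castSucc, y i.castSucc, z i.castSucc] := by
    intro i; fin_cases i <;> rfl
  rw [mul_apply, Fin.sum_univ_three]
  simp only [mul_diagonal, transpose_apply, hc, Pi.inv_apply, cons_val]

lemma lor_combination_self {x y z : Fin 4 → ℝ} (hxy : lor x y = 0) (hxz : lor x z = 0)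
    (hyz : lor y z = 0) (a b c : ℝ) :
    lor (a • x + b • y + c • z) (a • x + b • y + c • z) =
      a ^ 2 * lor x x + b ^ 2 * lor y y + c ^ 2 * lor z z := by
  simp only [lor_add_left, lor_add_right, lor_smul_left, lor_smul_right, lor_comm y x,
    lor_comm z x, lor_comm z y, hxy, hxz, hyz]
  ring

lemma IsAdaptedFrame.exists_confocal {V H : ℤ → Sphere Plane} (hVr : ∀ i, 0 < (V i).radius)
    (hHr : ∀ j, 0 < (H j).radius) (gV : GenericCircles V) (gH : GenericCircles H)
    {a₁ a₂ s b₁ b₂ t : ℤ → ℝ} {g₁ g₂ k l : Fin 4 → ℝ}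
    (F : IsAdaptedFrame (fun i => unitVec (V i)) (fun j => unitVec (H j))
      a₁ a₂ s b₁ b₂ t g₁ g₂ k l) :
    ∃ QH QV : Conic, (∀ j, QH.Contains (H j).center) ∧ (∀ i, QV.Contains (V i).center) ∧
      QH.Confocal QV := by
  have detH : ∀ i j m : ℤ, i < j → j < m → m ≤ i + 4 → det₃ g₁ g₂ l *
      (b₁ i * (b₂ j * t m - t j * b₂ m) - b₂ i * (b₁ j * t m - t j * b₁ m)
        + t i * (b₁ j * b₂ m - b₂ j * b₁ m)) ≠ 0 := by
    intro i j m hij hjm hmi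
    have := det₃_unitVec_ne_zero (hHr i).ne' (hHr j).ne' (hHr m).ne' (gH.centers i j m hij hjm hmi)
    have e := det₃_combination g₁ g₂ l ![b₁ i, b₂ i, t i] ![b₁ j, b₂ j, t j] ![b₁ m, b₂ m, t m]
    simp only [cons_val, ← F.h_eq] at e
    rwa [e] at this
  have hX : (colMat g₁ g₂ l).det ≠ 0 := by
    rw [det_colMat]
    exact left_ne_zero_of_mul (detH 0 1 2 (by norm_num) (by norm_num) (by norm_num))
  have hY : (colMat g₁ g₂ k).det ≠ 0 := by
    have := det₃_unitVec_ne_zero (hVr 0).ne' (hVr 1).ne' (hVr 2).ne'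
      (gV.centers 0 1 2 (by norm_num) (by norm_num) (by norm_num))
    have e := det₃_combination g₁ g₂ k ![a₁ 0 / lor g₁ g₁, a₂ 0 / lor g₂ g₂, s 0]
      ![a₁ 1 / lor g₁ g₁, a₂ 1 / lor g₂ g₂, s 1] ![a₁ 2 / lor g₁ g₁, a₂ 2 / lor g₂ g₂, s 2]
    simp only [cons_val, ← F.v_eq] at e
    rw [det_colMat]
    exact left_ne_zero_of_mul (e ▸ this)
  have qH : ∀ j, (1 - lor g₁ g₁) * b₁ j ^ 2 + (1 - lor g₂ g₂) * b₂ j ^ 2 +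
      (-lor l l) * t j ^ 2 = 0 := by
    intro j
    have e := lor_unitVec_self (hHr j).ne'
    rw [F.h_eq j, lor_combination_self F.g₁_g₂ F.g₁_l F.g₂_l] at e
    linear_combination F.b_unit j - e
  -- Non-degeneracy of both conics: the same factors occur in the form `qV`.
  have d1 : 1 - lor g₁ g₁ ≠ 0 := coeff_ne_zero_of_five_points (neg_ne_zero.mpr F.l_l) qH
    fun i j m hij hjm hmi => right_ne_zero_of_mul (detH i j m hij hjm hmi)
  have d2 : 1 - lor g₂ g₂ ≠ 0 := by
    refine coeff_ne_zero_of_five_points (x := b₂) (y := b₁) (z := t) (d₂ := 1 - lor g₁ g₁)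
      (neg_ne_zero.mpr F.l_l)
      (fun j => by linear_combination qH j)
      fun i j m hij hjm hmi h0 => right_ne_zero_of_mul (detH i j m hij hjm hmi) ?_
    linear_combination -h0
  have qV : ∀ i, lor g₁ g₁ * (lor g₁ g₁ - 1) * (a₁ i / lor g₁ g₁) ^ 2 +
      lor g₂ g₂ * (lor g₂ g₂ - 1) * (a₂ i / lor g₂ g₂) ^ 2 + (-lor k k) * s i ^ 2 = 0 := by
    intro i
    have e := lor_unitVec_self (hVr i).ne'
    rw [F.v_eq i, lor_combination_self F.g₁_g₂ F.g₁_k F.g₂_k] at e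
    have e1 : lor g₁ g₁ * (a₁ i / lor g₁ g₁) = a₁ i := mul_div_cancel₀ _ F.g₁_g₁
    have e2 : lor g₂ g₂ * (a₂ i / lor g₂ g₂) = a₂ i := mul_div_cancel₀ _ F.g₂_g₂
    linear_combination F.a_unit i - e + (lor g₁ g₁ * (a₁ i / lor g₁ g₁) + a₁ i) * e1 +
      (lor g₂ g₂ * (a₂ i / lor g₂ g₂) + a₂ i) * e2
  have n1 := F.g₁_g₁
  have n2 := F.g₂_g₂
  have n3 := F.k_k
  have n4 := F.l_l
  have f1 : lor g₁ g₁ - 1 ≠ 0 := by rw [← neg_sub]; exact neg_ne_zero.mpr d1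
  have f2 : lor g₂ g₂ - 1 ≠ 0 := by rw [← neg_sub]; exact neg_ne_zero.mpr d2
  have hdH : ∀ i, ![1 - lor g₁ g₁, 1 - lor g₂ g₂, -lor l l] i ≠ 0 := by
    intro i; fin_cases i <;> simp [d1, d2, n4]
  have hdV : ∀ i, ![lor g₁ g₁ * (lor g₁ g₁ - 1), lor g₂ g₂ * (lor g₂ g₂ - 1),
      -lor k k] i ≠ 0 := by
    intro i; fin_cases i <;> simp [f1, f2, n1, n2, n3]
  refine ⟨Conic.ofDiagonal _ hX _ hdH, Conic.ofDiagonal _ hY _ hdV, fun j => ?_, fun i => ?_, ?_⟩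
  · refine Conic.contains_ofDiagonal hX hdH _ (homog_center_eq (hHr j).ne' (F.h_eq j)) ?_
    simpa [Fin.sum_univ_three] using qH j
  · refine Conic.contains_ofDiagonal hY hdV _ (homog_center_eq (hVr i).ne' (F.v_eq i)) ?_
    simpa [Fin.sum_univ_three] using qV i
  · apply Conic.confocal_of_add_eq
    rw [Conic.dualMat_ofDiagonal, Conic.dualMat_ofDiagonal]
    -- By the partial fractions `pf` the sum becomes minus the inverse Lorentz form, whose upper
    -- left block is `absoluteDual`.
    have key : ∀ p q : Fin 4,
        g₁ p * (1 - lor g₁ g₁)⁻¹ * g₁ q + g₂ p * (1 - lor g₂ g₂)⁻¹ * g₂ q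
          + l p * (-lor l l)⁻¹ * l q +
        (g₁ p * (lor g₁ g₁ * (lor g₁ g₁ - 1))⁻¹ * g₁ q +
          g₂ p * (lor g₂ g₂ * (lor g₂ g₂ - 1))⁻¹ * g₂ q + k p * (-lor k k)⁻¹ * k q) =
        -!![1, 0, 0, 0; 0, 1, 0, 0; 0, 0, 0, -2; 0, 0, -2, (0 : ℝ)] p q := by
      intro p q
      rw [← sum_orthogonal_basis F.k_l F.g₁_g₂ F.g₁_k F.g₂_k F.g₁_l F.g₂_l n3 n4 n1 n2 p q]
      have pf : ∀ c : ℝ, c ≠ 0 → c - 1 ≠ 0 → (1 - c)⁻¹ + (c * (c - 1))⁻¹ = -c⁻¹ := by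
        intro c hc hc'
        have : 1 - c ≠ 0 := by rw [← neg_sub]; exact neg_ne_zero.mpr hc'
        field_simp
        ring
      simp only [inv_neg, div_eq_mul_inv]
      linear_combination g₁ p * g₁ q * pf _ n1 f1 + g₂ p * g₂ q * pf _ n2 f2
    ext i j
    rw [Matrix.add_apply, colMat_mul_diagonal_mul_apply, colMat_mul_diagonal_mul_apply, key]
    fin_cases i <;> fin_cases j <;> simp [absoluteDual]

end CircularNet

theorem mainTheorem9
    (P : ℤ → ℤ → Plane) (hP : IsCircularNet P)
    (V H : ℤ → EuclideanGeometry.Sphere Plane)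
    (hVr : ∀ i, 0 < (V i).radius) (hHr : ∀ j, 0 < (H j).radius)
    (hV : ∀ i j, P i j ∈ V i) (hH : ∀ i j, P i j ∈ H j)
    (gP : GenericVertices P) (gV : GenericCircles V) (gH : GenericCircles H) :
    (∃ QH QV : Conic,
      (∀ j, QH.Contains (H j).center) ∧
      (∀ i, QV.Contains (V i).center) ∧
      QH.Confocal QV) ∧
    (∃ KH KV : GenCircle,
      (∀ j, KH.Orthogonal (GenCircle.ofSphere (H j) (hHr j))) ∧
      (∀ i, KV.Orthogonal (GenCircle.ofSphere (V i) (hVr i))) ∧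
      KH.Orthogonal KV) := by
  obtain ⟨a₁, a₂, b₁, b₂, ha, hb, hg⟩ := exists_lor_unitVec_eq hP hVr hHr hV hH gP
  obtain ⟨a₁, a₂, s, b₁, b₂, t, g₁, g₂, k, l, F⟩ := exists_isAdaptedFrame
    (v := fun i => unitVec (V i)) (h := fun j => unitVec (H j))
    (det₃_unitVec_ne_zero (hVr 0).ne' (hVr 1).ne' (hVr 2).ne'
      (gV.centers 0 1 2 (by norm_num) (by norm_num) (by norm_num)))
    (det₃_unitVec_ne_zero (hHr 0).ne' (hHr 1).ne' (hHr 2).ne'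
      (gH.centers 0 1 2 (by norm_num) (by norm_num) (by norm_num)))
    ha hb hg (lor_self_ne_zero_of_generic hVr gV) (lor_self_ne_zero_of_generic hHr gH)
  exact ⟨F.exists_confocal hVr hHr gV gH, genCircleOf k F.k_k, genCircleOf l F.l_l,
    fun j => genCircleOf_orthogonal_ofSphere F.k_k F.k_two (hHr j) (F.k_h j),
    fun i => genCircleOf_orthogonal_ofSphere F.l_l F.l_two (hVr i) (F.l_v i),
    genCircleOf_orthogonal F.k_k F.l_l F.k_two F.l_two F.k_l⟩
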